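/- Let $\mathrm{SU}(2,1)$ be the group of complex $3\times 3$ matrices of determinant one which preserve the form $\langle Z,W\rangle=Z_1\overline{W}_1+Z_2\overline{W}_2-Z_3\overline{W}_3$ on $\mathbf{C}^3$, and write $t_A$ for the trace of a matrix $A$ and $[A,B]=ABA^{-1}B^{-1}$. Let $p,q,r$ be pairwise coprime positive integers and let $a,b,c$ be integers with $$\frac{a}{p}+\frac{b}{q}+\frac{c}{r}=\frac{1}{pqr}.$$ Let $\Sigma(p,q,r)=\{(u,v,w)\in\mathbf{C}^3 : u^p+v^q+w^r=0\}\cap \mathbf{S}^5_{\epsilon}$ ($\epsilon>0$) be the Brieskorn homology sphere, with its fundamental group presented as $$\pi_1(\Sigma(p,q,r))=\langle x,y,z,h \mid h\ \text{central},\ x^ph^a=y^qh^b=z^rh^c=xyz=1\rangle .$$ A homomorphism $\rho:\pi_1(\Sigma(p,q,r))\to\mathrm{SU}(2,1)$ is called irreducible if no linear subspace of $\mathbf{C}^3$ other than $0$ and $\mathbf{C}^3$ is invariant under its image; two homomorphisms $\rho,\rho'$ are called conjugate if there is $g\in\mathrm{SU}(2,1)$ with $\rho'(\gamma)=g\rho(\gamma)g^{-1}$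 for all $\gamma$. **Theorem 3.1.** Two irreducible representations $\rho,\rho':\pi_1(\Sigma(p,q,r))\to\mathrm{SU}(2,1)$ are conjugate if and only if $\rho(x)$ and $\rho'(x)$ are conjugate in $\mathrm{SU}(2,1)$, $\rho(y)$ and $\rho'(y)$ are conjugate in $\mathrm{SU}(2,1)$, $\rho(h)$ and $\rho'(h)$ are conjugate in $\mathrm{SU}(2,1)$, and $$t_{\rho(xy)}=t_{\rho'(xy)},\qquad t_{\rho(x^{-1}y)}=t_{\rho'(x^{-1}y)},\qquad \operatorname{Im} t_{\rho([x,y])}=\operatorname{Im} t_{\rho'([x,y])}.$$ This holds for the group given by the presentation, and for the topological fundamental group of $\Sigma(p,q,r)$ at any base point with any choice of elements $x,y,z,h$ which gives this presentation. -/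

import Mathlib

open Matrix

/-- The indefinite Hermitian form `⟨Z, W⟩ = Z₁ W̄₁ + Z₂ W̄₂ - Z₃ W̄₃` on `ℂ³`. -/
def hermForm21 (Z W : Fin 3 → ℂ) : ℂ :=
  Z 0 * star (W 0) + Z 1 * star (W 1) - Z 2 * star (W 2)

/-- The underlying matrix of an element of `SL(3,ℂ)`, as a multiplicative map. -/
def slMatrix : SpecialLinearGroup (Fin 3) ℂ →* Matrix (Fin 3) (Fin 3) ℂ where
  toFun A := A.1
  map_one' := rfl
  map_mul' _ _ := rfl

/-- The group `SU(2,1)`: complex `3 × 3` matrices of determinant one which preserve the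
Hermitian form of signature `(2,1)`. -/
def SU21 : Subgroup (SpecialLinearGroup (Fin 3) ℂ) where
  carrier := {A | ∀ Z W : Fin 3 → ℂ,
    hermForm21 (slMatrix A *ᵥ Z) (slMatrix A *ᵥ W) = hermForm21 Z W}
  one_mem' := by
    intro Z W
    simp
  mul_mem' := by
    intro A B hA hB Z W
    rw [map_mul, ← mulVec_mulVec, ← mulVec_mulVec, hA, hB]
  inv_mem' := by
    intro A hA Z W
    have key : ∀ V : Fin 3 → ℂ, slMatrix A *ᵥ (slMatrix A⁻¹ *ᵥ V) = V := by
      intro V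
      rw [mulVec_mulVec, ← map_mul, mul_inv_cancel, map_one, one_mulVec]
    rw [← hA, key, key]

/-- The trace of an element of `SU(2,1)`. -/
def trSU21 (A : SU21) : ℂ :=
  Matrix.trace (slMatrix A)

/-- The standard representation of `SU(2,1)` on `ℂ³`. -/
noncomputable def stdRepSU21 : Representation ℂ SU21 (Fin 3 → ℂ) where
  toFun A := Matrix.toLin' (slMatrix A)
  map_one' := Matrix.toLin'_one
  map_mul' _ _ := Matrix.toLin'_mul _ _

section Rep

variable {G : Type*} [Group G]

/-- A homomorphism into `SU(2,1)` is irreducible if `ℂ³` has no invariant subspace other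
than `0` and `ℂ³`, i.e. if the resulting linear representation on `ℂ³` is irreducible. -/
def IsIrreducibleSU21 (ρ : G →* SU21) : Prop :=
  Representation.IsIrreducible (stdRepSU21.comp ρ : Representation ℂ G (Fin 3 → ℂ))

/-- Two homomorphisms into `SU(2,1)` are conjugate if they differ by an inner automorphism
of `SU(2,1)`. -/
def AreConjugateSU21 (ρ ρ' : G →* SU21) : Prop :=
  ∃ g : SU21, ∀ γ : G, ρ' γ = g * ρ γ * g⁻¹

/-- The images of each of `x`, `y`, `h` under `ρ` and `ρ'` are conjugate in `SU(2,1)`, and the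
trace coordinates `t_{ρ(xy)}`, `t_{ρ(x⁻¹y)}`, `Im t_{ρ([x,y])}` of `ρ` and `ρ'` agree. -/
def HaveSameCoordinates (x y h : G) (ρ ρ' : G →* SU21) : Prop :=
  (IsConj (ρ x) (ρ' x) ∧ IsConj (ρ y) (ρ' y) ∧ IsConj (ρ h) (ρ' h)) ∧
    trSU21 (ρ (x * y)) = trSU21 (ρ' (x * y)) ∧
    trSU21 (ρ (x⁻¹ * y)) = trSU21 (ρ' (x⁻¹ * y)) ∧
    (trSU21 (ρ (x * y * x⁻¹ * y⁻¹))).im = (trSU21 (ρ' (x * y * x⁻¹ * y⁻¹))).im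

end Rep

/-- The Brieskorn homology sphere `Σ(p,q,r)`, as the intersection of the surface
`x^p + y^q + z^r = 0` with the sphere of radius `ε` around the origin of `ℂ³`. -/
def BrieskornSphere (p q r : ℕ) (ε : ℝ) : Set (EuclideanSpace ℂ (Fin 3)) :=
  {v | v 0 ^ p + v 1 ^ q + v 2 ^ r = 0} ∩ Metric.sphere 0 ε

/-- Names of the four generators of the fundamental group. -/
inductive BrieskornGen : Type
  | x
  | y
  | z
  | h

/-- The relators of the presentation
`⟨x, y, z, h | h central, x^p h^a = y^q h^b = z^r h^c = x y z = 1⟩`. -/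
def brieskornRels (p q r : ℕ) (a b c : ℤ) : Set (FreeGroup BrieskornGen) :=
  let x := FreeGroup.of BrieskornGen.x
  let y := FreeGroup.of BrieskornGen.y
  let z := FreeGroup.of BrieskornGen.z
  let h := FreeGroup.of BrieskornGen.h
  {h * x * h⁻¹ * x⁻¹, h * y * h⁻¹ * y⁻¹, h * z * h⁻¹ * z⁻¹,
    x ^ p * h ^ a, y ^ q * h ^ b, z ^ r * h ^ c, x * y * z}

/-- The group `⟨x, y, z, h | h central, x^p h^a = y^q h^b = z^r h^c = x y z = 1⟩`. -/
abbrev BrieskornGroup (p q r : ℕ) (a b c : ℤ) : Type :=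
  PresentedGroup (brieskornRels p q r a b c)

/-- The element of the presented group which a generator represents. -/
def brieskornElt (p q r : ℕ) (a b c : ℤ) (s : BrieskornGen) : BrieskornGroup p q r a b c :=
  PresentedGroup.of s

/-! An irreducible representation is determined up to conjugacy by its character, so it suffices to
recover the trace of every `ρ γ` from the coordinates. The group is generated by `x`, `y` and the
central `h`; by Schur `ρ h` is scalar, hence equal to its conjugate `ρ' h`, and only traces of words
in `ρ(x)`, `ρ(y)` and their inverses remain.

In `SL₃` the adjugate is the inverse, so polarized Cayley–Hamilton trades a repeated letter for
shorter words (`trace_prod_eq_of_nodup`). Words without repetition reduce, by cancellation and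
cyclicity, to words of length at most two and the two commutators (`trace_prod_letterMatrix_eq`). In
`SU(2,1)` inversion conjugates the trace, so the two commutator traces are conjugate; their sum is a
polynomial in the other traces (`trace_commutator_add`), which leaves only the imaginary part as new
data.

Equality of characters gives a conjugating matrix by Burnside and Skolem–Noether; Schur, applied to
the pulled-back form, shows that it can be taken in `SU(2,1)` (`areConjugateSU21_of_trace_eq`). -/

section TraceIdentities

/-- The polarized Cayley–Hamilton identity for `3 × 3` matrices, which shortens `Q * P * Q`. -/
theorem mul_mul_self_eq_adjugate {R : Type*} [CommRing R] (Q P : Matrix (Fin 3) (Fin 3) R) :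
    Q * P * Q = -(adjugate Q * P) - P * adjugate Q + trace (adjugate Q) • P
      + trace P • adjugate Q + trace (P * Q) • Q
      + (trace (P * adjugate Q) - trace P * trace (adjugate Q)) • (1 : Matrix (Fin 3) (Fin 3) R) := by
  rw [adjugate_fin_three]
  ext i j
  fin_cases i <;> fin_cases j <;>
    simp [Matrix.mul_apply, Fin.sum_univ_three, trace_fin_three, vecMul, dotProduct] <;> ring

/-- For `det Q = 1` the adjugate is the letter `Q⁻¹`, so every trace on the right is that of a
shorter word. -/
theorem trace_mul_mul_self_mul {R : Type*} [CommRing R] (Q P W : Matrix (Fin 3) (Fin 3) R) :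
    trace (Q * P * Q * W) = -trace (adjugate Q * P * W) - trace (P * adjugate Q * W)
      + trace (adjugate Q) * trace (P * W) + trace P * trace (adjugate Q * W)
      + trace (P * Q) * trace (Q * W)
      + (trace (P * adjugate Q) - trace P * trace (adjugate Q)) * trace W := by
  rw [mul_mul_self_eq_adjugate]
  simp only [add_mul, sub_mul, neg_mul, smul_mul_assoc, one_mul, trace_add, trace_sub, trace_neg,
    trace_smul, smul_eq_mul]

/-- The traces of the two commutators of `X, Y ∈ SL₃` add up to a polynomial in the traces of
`X, X⁻¹, Y, Y⁻¹, XY, (XY)⁻¹, X⁻¹Y, Y⁻¹X`. -/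
theorem trace_commutator_add {R : Type*} [CommRing R] {X x Y y : Matrix (Fin 3) (Fin 3) R}
    (hX : adjugate X = x) (hx : adjugate x = X) (hXx : X * x = 1) (hxX : x * X = 1)
    (hYy : Y * y = 1) (hyY : y * Y = 1) :
    trace (X * Y * x * y) + trace (Y * X * y * x) =
      -(trace x * (trace X + trace Y * trace (y * X) + trace (x * Y) * trace (x * y)
          + (trace (X * Y) - trace X * trace Y) * trace y) - trace X * trace x)
      - (trace x * (trace x ^ 2 - 2 * trace X) - trace X * trace x + 3)
      + trace x * (trace x ^ 2 - 2 * trace X)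
      + trace Y * (trace x * (trace x * trace (x * y) - trace X * trace y + trace (y * X))
          - trace X * trace (x * y) + trace y)
      + trace (X * Y) * trace (x * y)
      + (trace (x * Y) - trace Y * trace x)
        * (trace x * trace (x * y) - trace X * trace y + trace (y * X)) := by
  -- Cayley–Hamilton for `x` divided by `x`: the polarized identity at `P = 1`.
  have hxx : x * x = trace x • x - trace X • (1 : Matrix (Fin 3) (Fin 3) R) + X := by
    have h := mul_mul_self_eq_adjugate x 1
    simp only [hx, mul_one, one_mul, trace_one, Fintype.card_fin] at h
    rw [h]
    module
  have t3 : trace (1 : Matrix (Fin 3) (Fin 3) R) = 3 := by simp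
  have txx : trace (x * x) = trace x ^ 2 - 2 * trace X := by
    rw [hxx]; simp [t3]; ring
  have txxx : trace (x * (x * x)) = trace x * trace (x * x) - trace X * trace x + 3 := by
    conv_lhs => rw [hxx]
    simp [mul_add, mul_sub, hxX, t3]
  have cXy : trace (X * y) = trace (y * X) := trace_mul_comm _ _
  have txxy : trace (x * x * y) = trace x * trace (x * y) - trace X * trace y + trace (y * X) := by
    rw [hxx]; simp [add_mul, sub_mul, cXy]
  have txxxy : trace (x * (x * x * y)) =
      trace x * trace (x * x * y) - trace X * trace (x * y) + trace y := by
    conv_lhs => rw [hxx]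
    simp [add_mul, sub_mul, mul_add, mul_sub, ← mul_assoc, hxX]
  have txYxy : trace (x * Y * x * y) = trace X + trace Y * trace (y * X)
      + trace (x * Y) * trace (x * y) + (trace (X * Y) - trace X * trace Y) * trace y := by
    rw [trace_mul_mul_self_mul, hx]
    have h1 : X * Y * y = X := by rw [mul_assoc, hYy, mul_one]
    have h2 : trace (Y * X * y) = trace X := by
      rw [trace_mul_comm, ← mul_assoc, hyY, one_mul]
    rw [h1, h2, hYy, t3, cXy, trace_mul_comm Y x, trace_mul_comm Y X]
    ring
  -- Reducing the square produces `x Y X y`, a rotation of the other commutator.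
  have txYxxy : trace (x * Y * (x * x * y)) =
      trace x * trace (x * Y * x * y) - trace X * trace x + trace (Y * X * y * x) := by
    rw [hxx]
    have h1 : x * Y * y = x := by rw [mul_assoc, hYy, mul_one]
    have h2 : trace (x * Y * X * y) = trace (Y * X * y * x) := by
      rw [trace_mul_comm (Y * X * y) x]; simp only [mul_assoc]
    simp [add_mul, sub_mul, mul_add, mul_sub, ← mul_assoc, h1, h2]
  -- Writing `X Y x y` as `X Y X (x² y)` creates the repeated letter that the identity needs.
  have key := trace_mul_mul_self_mul X Y (x * x * y)
  have e1 : X * Y * X * (x * x * y) = X * Y * x * y := by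
    rw [mul_assoc x, mul_assoc (X * Y), ← mul_assoc X x, hXx, one_mul, mul_assoc (X * Y)]
  have e2 : trace (Y * x * (x * x * y)) = trace (x * (x * x)) := by
    have : Y * x * (x * x * y) = Y * (x * (x * x)) * y := by simp only [mul_assoc]
    rw [this, trace_mul_comm, ← mul_assoc, hyY, one_mul]
  have e3 : trace (Y * (x * x * y)) = trace (x * x) := by
    rw [← mul_assoc, trace_mul_comm, ← mul_assoc, hyY, one_mul]
  have e4 : X * (x * x * y) = x * y := by
    rw [← mul_assoc, ← mul_assoc, hXx, one_mul]
  rw [hX, e1, e2, e3, e4, txxxy, txYxxy, txxx, trace_mul_comm Y X, trace_mul_comm Y x, txYxy,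
    txxy, txx] at key
  rw [key]
  ring

end TraceIdentities

/-! ### Reduction of traces of words -/

section Words

/-- The involution exchanging a letter with its formal inverse. -/
def invLetter (l : Bool × Bool) : Bool × Bool := (l.1, !l.2)

theorem List.exists_eq_append_of_not_nodup {α : Type*} {w : List α} (h : ¬ w.Nodup) :
    ∃ (U : List α) (a : α) (P W : List α), w = U ++ a :: (P ++ a :: W) := by
  induction w with
  | nil => simp at h
  | cons b w ih =>
    by_cases hb : b ∈ w
    · obtain ⟨P, W, rfl⟩ := List.append_of_mem hb
      exact ⟨[], b, P, W, rfl⟩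
    · have : ¬ w.Nodup := fun hw => h (List.nodup_cons.2 ⟨hb, hw⟩)
      obtain ⟨U, a, P, W, rfl⟩ := ih this
      exact ⟨b :: U, a, P, W, rfl⟩

variable {R : Type*} [CommRing R]

theorem trace_prod_append_comm (e : Bool × Bool → Matrix (Fin 3) (Fin 3) R)
    (U V : List (Bool × Bool)) :
    trace ((U ++ V).map e).prod = trace ((V ++ U).map e).prod := by
  simp only [List.map_append, List.prod_append]
  exact trace_mul_comm _ _

/-- The traces of two pairs of matrices in `SL₃` agree on all words in the matrices and their
inverses as soon as they agree on the words without a repeated letter. -/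
theorem trace_prod_eq_of_nodup {e e' : Bool × Bool → Matrix (Fin 3) (Fin 3) R}
    (he : ∀ l, adjugate (e l) = e (invLetter l)) (he' : ∀ l, adjugate (e' l) = e' (invLetter l))
    (h : ∀ w : List (Bool × Bool), w.Nodup →
      trace (w.map e).prod = trace (w.map e').prod) (w : List (Bool × Bool)) :
    trace (w.map e).prod = trace (w.map e').prod := by
  induction hn : w.length using Nat.strong_induction_on generalizing w with
  | _ n ih =>
  by_cases hw : w.Nodup
  · exact h w hw
  obtain ⟨U, l, P, W, rfl⟩ := List.exists_eq_append_of_not_nodup hw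
  have short : ∀ v : List (Bool × Bool), v.length < n →
      trace (v.map e).prod = trace (v.map e').prod := fun v hv => ih _ hv v rfl
  have red : ∀ f : Bool × Bool → Matrix (Fin 3) (Fin 3) R,
      (∀ l, adjugate (f l) = f (invLetter l)) →
      trace ((U ++ l :: (P ++ l :: W)).map f).prod =
        -trace ((invLetter l :: (P ++ (W ++ U))).map f).prod
        - trace ((P ++ invLetter l :: (W ++ U)).map f).prod
        + trace ([invLetter l].map f).prod * trace ((P ++ (W ++ U)).map f).prod
        + trace (P.map f).prod * trace ((invLetter l :: (W ++ U)).map f).prod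
        + trace ((P ++ [l]).map f).prod * trace ((l :: (W ++ U)).map f).prod
        + (trace ((P ++ [invLetter l]).map f).prod
            - trace (P.map f).prod * trace ([invLetter l].map f).prod)
          * trace ((W ++ U).map f).prod := by
    intro f hf
    have key := trace_mul_mul_self_mul (f l) (P.map f).prod ((W ++ U).map f).prod
    -- Rotating `U` to the end makes the word start with its repeated letter.
    rw [trace_prod_append_comm]
    simpa only [hf, List.map_append, List.map_cons, List.map_nil, List.prod_append, List.prod_cons,
      List.prod_nil, mul_one, mul_assoc, List.append_assoc, List.cons_append] using key
  simp only [List.length_append, List.length_cons] at hn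
  rw [red e he, red e' he']
  congr 1
  · congr 1
    · congr 1
      · congr 1
        · congr 1
          · congr 1
            exact short _ (by grind)
          · exact short _ (by grind)
        · congr 1 <;> exact short _ (by grind)
      · congr 1 <;> exact short _ (by grind)
    · congr 1 <;> exact short _ (by grind)
  · congr 1
    · congr 1
      · exact short _ (by grind)
      · congr 1 <;> exact short _ (by grind)
    · exact short _ (by grind)

/-- The four matrices `X, X⁻¹, Y, Y⁻¹`, indexed by letters. -/
def letterMatrix (X x Y y : Matrix (Fin 3) (Fin 3) R) : Bool × Bool → Matrix (Fin 3) (Fin 3) R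
  | (true, true) => X
  | (true, false) => x
  | (false, true) => Y
  | (false, false) => y

/-- The trace of a word without a repeated letter is determined by the traces of the words of length
at most two and of the two commutators. -/
theorem trace_prod_letterMatrix_eq {X x Y y X' x' Y' y' : Matrix (Fin 3) (Fin 3) R}
    (hXx : X * x = 1) (hxX : x * X = 1) (hYy : Y * y = 1) (hyY : y * Y = 1)
    (hXx' : X' * x' = 1) (hxX' : x' * X' = 1) (hYy' : Y' * y' = 1) (hyY' : y' * Y' = 1)
    (tX : trace X = trace X') (tx : trace x = trace x')
    (tY : trace Y = trace Y') (ty : trace y = trace y')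
    (tXY : trace (X * Y) = trace (X' * Y')) (txy : trace (x * y) = trace (x' * y'))
    (txY : trace (x * Y) = trace (x' * Y')) (tXy : trace (X * y) = trace (X' * y'))
    (tc : trace (X * Y * x * y) = trace (X' * Y' * x' * y'))
    (td : trace (Y * X * y * x) = trace (Y' * X' * y' * x'))
    (w : List (Bool × Bool)) (hw : w.Nodup) :
    trace (w.map (letterMatrix X x Y y)).prod = trace (w.map (letterMatrix X' x' Y' y')).prod := by
  have tyx : trace (y * x) = trace (y' * x') := by rw [trace_mul_comm, txy, trace_mul_comm]
  have tYX : trace (Y * X) = trace (Y' * X') := by rw [trace_mul_comm, tXY, trace_mul_comm]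
  have tyX : trace (y * X) = trace (y' * X') := by rw [trace_mul_comm, tXy, trace_mul_comm]
  have tYx : trace (Y * x) = trace (Y' * x') := by rw [trace_mul_comm, txY, trace_mul_comm]
  have cancel : ∀ {A B : Matrix (Fin 3) (Fin 3) R}, A * B = 1 → ∀ M, A * (B * M) = M := by
    intro A B h M
    rw [← mul_assoc, h, one_mul]
  have sandwich : ∀ {A B : Matrix (Fin 3) (Fin 3) R}, B * A = 1 → ∀ M,
      trace (A * (M * B)) = trace M := by
    intro A B h M
    rw [trace_mul_comm, mul_assoc, h, mul_one]
  have rot : ∀ {A B C D A' B' C' D' : Matrix (Fin 3) (Fin 3) R},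
      trace (A * (B * (C * D))) = trace (A' * (B' * (C' * D'))) →
      trace (D * (A * (B * C))) = trace (D' * (A' * (B' * C'))) := by
    intro A B C D A' B' C' D' h
    rw [trace_mul_comm D, trace_mul_comm D']
    simpa only [mul_assoc] using h
  simp only [mul_assoc] at tc td
  -- Three distinct letters contain an inverse pair, adjacent up to rotation, which cancels. Four
  -- letters escape cancellation only if the `X`-letters and `Y`-letters alternate, that is, for the
  -- rotations of the two commutators.
  have tc₁ := rot tc
  have tc₂ := rot tc₁
  have tc₃ := rot tc₂
  have td₁ := rot td
  have td₂ := rot td₁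
  have td₃ := rot td₂
  have hlen : w.length ≤ 4 := by simpa using hw.length_le_card
  match w, hlen with
  | [], _ => simp
  | [a], _ =>
    rcases a with ⟨_ | _, _ | _⟩ <;> simpa [letterMatrix]
  | [a, b], _ =>
    rcases a with ⟨_ | _, _ | _⟩ <;> rcases b with ⟨_ | _, _ | _⟩ <;>
      first
      | (exfalso; revert hw; decide)
      | simp [letterMatrix, *]
  | [a, b, c], _ =>
    rcases a with ⟨_ | _, _ | _⟩ <;> rcases b with ⟨_ | _, _ | _⟩ <;>
      rcases c with ⟨_ | _, _ | _⟩ <;>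
      first
      | (exfalso; revert hw; decide)
      | simp [letterMatrix, *]
  | [a, b, c, d], _ =>
    rcases a with ⟨_ | _, _ | _⟩ <;> rcases b with ⟨_ | _, _ | _⟩ <;>
      rcases c with ⟨_ | _, _ | _⟩ <;> rcases d with ⟨_ | _, _ | _⟩ <;>
      first
      | (exfalso; revert hw; decide)
      | simp [letterMatrix, *]

end Words

/-! ### Burnside, Skolem–Noether and characters -/

section CharacterTheory

open scoped MonoidAlgebra

/-- **Burnside's theorem**: an irreducible finite-dimensional representation over an algebraically
closed field spans the endomorphism algebra. -/
theorem Representation.IsIrreducible.asAlgebraHom_surjective {k G V : Type*} [Field k]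
    [IsAlgClosed k] [Group G] [AddCommGroup V] [Module k V] [FiniteDimensional k V]
    (ρ : Representation k G V) [ρ.IsIrreducible] : Function.Surjective ρ.asAlgebraHom := by
  intro f
  -- By Schur the commutant consists of scalars, so every linear `f` is linear over it, and the
  -- density theorem matches `f` on a basis.
  let F : Module.End (Module.End k[G] ρ.asModule) ρ.asModule :=
    { toFun := fun v => ρ.asModuleEquiv.symm (f (ρ.asModuleEquiv v))
      map_add' := by simp
      map_smul' := by
        intro φ v
        obtain ⟨c, rfl⟩ :=
          (IsSimpleModule.algebraMap_end_bijective_of_isAlgClosed (A := k[G])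
            (V := ρ.asModule) k).2 φ
        simp }
  let b := Module.finBasis k ρ.asModule
  obtain ⟨r, hr⟩ := jacobson_density (R := k[G]) F (Set.finite_range b).toFinset
  refine ⟨r, ?_⟩
  have hb : ∀ i, ρ.asAlgebraHom r (ρ.asModuleEquiv (b i)) = f (ρ.asModuleEquiv (b i)) := by
    intro i
    have := hr (b i) (by simp)
    rw [← Representation.asModuleEquiv_map_smul, ← this]
    simp [F]
  exact (b.map ρ.asModuleEquiv).ext fun i => by simpa using hb i

/-- Two surjections onto a matrix algebra over a field which have the same trace are conjugate. -/
theorem exists_conj_of_trace_eq {k A n : Type*} [Field k] [Ring A] [Algebra k A] [Fintype n]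
    [DecidableEq n] {f f' : A →ₐ[k] Matrix n n k} (hf : Function.Surjective f)
    (hf' : Function.Surjective f') (h : ∀ a, trace (f a) = trace (f' a)) :
    ∃ g : Matrix n n k, IsUnit g ∧ ∀ a, g * f a = f' a * g := by
  have ker_le : ∀ {f f' : A →ₐ[k] Matrix n n k}, Function.Surjective f' →
      (∀ a, trace (f a) = trace (f' a)) → RingHom.ker f ≤ RingHom.ker f' := by
    intro f f' hf' h a ha
    rw [RingHom.mem_ker] at ha ⊢
    -- The trace form is nondegenerate, so the traces determine the kernel.
    rw [ext_iff_trace_mul_right]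
    intro B
    obtain ⟨b, rfl⟩ := hf' B
    rw [← map_mul, ← h, map_mul, ha, zero_mul, zero_mul]
  have hker : RingHom.ker f = RingHom.ker f' :=
    le_antisymm (ker_le hf' h) (ker_le hf fun a => (h a).symm)
  let E : Matrix n n k ≃ₐ[k] Matrix n n k :=
    (Ideal.quotientKerAlgEquivOfSurjective hf).symm.trans
      ((Ideal.quotientEquivAlgOfEq k hker).trans (Ideal.quotientKerAlgEquivOfSurjective hf'))
  have hE : ∀ a, E (f a) = f' a := by
    intro a
    have : (Ideal.quotientKerAlgEquivOfSurjective hf).symm (f a) = Ideal.Quotient.mk _ a := by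
      rw [AlgEquiv.symm_apply_eq]
      rfl
    simp only [E, AlgEquiv.trans_apply, this]
    rfl
  -- Skolem–Noether: the induced automorphism `E` of the matrix algebra is inner.
  obtain ⟨T, hT⟩ := AlgEquiv.eq_linearEquivConjAlgEquiv
    ((toLinAlgEquiv' (R := k) (n := n)).symm.trans (E.trans toLinAlgEquiv'))
  refine ⟨LinearMap.toMatrix' T.toLinearMap, ?_, ?_⟩
  · refine IsUnit.of_mul_eq_one (LinearMap.toMatrix' T.symm.toLinearMap) ?_
    rw [← LinearMap.toMatrix'_comp]
    simp
  · intro a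
    have key := congrArg (fun φ => φ (toLinAlgEquiv' (f a))) hT
    have key' : toLin' (f' a) = T.toLinearMap ∘ₗ toLin' (f a) ∘ₗ T.symm.toLinearMap := by
      rw [← hE a]
      simp only [AlgEquiv.trans_apply, AlgEquiv.symm_apply_apply, LinearEquiv.conjAlgEquiv_apply]
        at key
      exact key
    have := congrArg (fun φ => LinearMap.toMatrix' (φ ∘ₗ T.toLinearMap)) key'
    simp only [LinearMap.comp_assoc, LinearEquiv.symm_comp, LinearMap.comp_id,
      LinearMap.toMatrix'_comp, LinearMap.toMatrix'_toLin'] at this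
    exact this.symm

end CharacterTheory

/-! ### Conjugacy inside `SU(2,1)` -/

section UnitaryGroup

/-- The Gram matrix of the form of signature `(2,1)`. -/
def gramSU21 : Matrix (Fin 3) (Fin 3) ℂ := diagonal ![1, 1, -1]

theorem gramSU21_mul_self : gramSU21 * gramSU21 = 1 := by
  rw [gramSU21, diagonal_mul_diagonal, ← diagonal_one]
  congr 1
  ext i
  fin_cases i <;> simp

theorem hermForm21_eq_dotProduct (Z W : Fin 3 → ℂ) :
    hermForm21 Z W = star W ⬝ᵥ (gramSU21 *ᵥ Z) := by
  simp [hermForm21, gramSU21, mulVec_diagonal, dotProduct, Fin.sum_univ_three]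
  ring

theorem mem_SU21_iff (A : SpecialLinearGroup (Fin 3) ℂ) :
    A ∈ SU21 ↔ A.1ᴴ * gramSU21 * A.1 = gramSU21 := by
  have key : ∀ Z W : Fin 3 → ℂ, hermForm21 (A.1 *ᵥ Z) (A.1 *ᵥ W) =
      star W ⬝ᵥ ((A.1ᴴ * gramSU21 * A.1) *ᵥ Z) := by
    intro Z W
    rw [hermForm21_eq_dotProduct, star_mulVec, ← dotProduct_mulVec, mulVec_mulVec, mulVec_mulVec,
      mul_assoc]
  change (∀ Z W, hermForm21 (A.1 *ᵥ Z) (A.1 *ᵥ W) = hermForm21 Z W) ↔ _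
  constructor
  · intro h
    ext i j
    have := h (Pi.single j 1) (Pi.single i 1)
    rw [key, hermForm21_eq_dotProduct] at this
    simpa using this
  · intro h Z W
    rw [key, h, hermForm21_eq_dotProduct]

theorem SU21.conjTranspose_mul_gram_mul (A : SU21) :
    (slMatrix A)ᴴ * gramSU21 * slMatrix A = gramSU21 :=
  (mem_SU21_iff A).1 A.2

theorem SU21.matrix_mul_inv (A : SU21) : slMatrix A * slMatrix (A⁻¹ : SU21) = 1 := by
  rw [← map_mul, ← Subgroup.coe_mul, mul_inv_cancel, Subgroup.coe_one, map_one]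

theorem SU21.matrix_inv (A : SU21) :
    slMatrix (A⁻¹ : SU21) = gramSU21 * (slMatrix A)ᴴ * gramSU21 := by
  have h : gramSU21 * (slMatrix A)ᴴ * gramSU21 * slMatrix A = 1 := by
    rw [mul_assoc, mul_assoc, ← mul_assoc _ gramSU21, SU21.conjTranspose_mul_gram_mul,
      gramSU21_mul_self]
  calc slMatrix (A⁻¹ : SU21)
      = gramSU21 * (slMatrix A)ᴴ * gramSU21 * slMatrix A * slMatrix (A⁻¹ : SU21) := by
        rw [h, one_mul]
    _ = _ := by rw [mul_assoc, SU21.matrix_mul_inv, mul_one]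

/-- Preserving the form makes `A⁻¹` similar to the conjugate transpose of `A`. -/
theorem trSU21_inv (A : SU21) : trSU21 A⁻¹ = star (trSU21 A) := by
  rw [trSU21, trSU21, SU21.matrix_inv, mul_assoc, trace_mul_comm, mul_assoc, gramSU21_mul_self,
    mul_one, trace_conjTranspose]

theorem trSU21_conj (g A : SU21) : trSU21 (g * A * g⁻¹) = trSU21 A := by
  simp only [trSU21, Subgroup.coe_mul, map_mul]
  rw [trace_mul_comm, ← mul_assoc, ← map_mul, ← Subgroup.coe_mul, inv_mul_cancel,
    Subgroup.coe_one, map_one, one_mul]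

theorem SU21.adjugate_matrix (A : SU21) : adjugate (slMatrix A) = slMatrix (A⁻¹ : SU21) :=
  (Matrix.SpecialLinearGroup.coe_inv A.1).symm

theorem SU21.ext_matrix {A B : SU21} (h : slMatrix A = slMatrix B) : A = B :=
  Subtype.ext (Subtype.ext h)

section Rep

variable {G : Type*} [Group G]

open scoped MonoidAlgebra in
/-- The extension of a homomorphism into `SU(2,1)` to the group algebra. -/
noncomputable def matrixAlgHom (ρ : G →* SU21) : ℂ[G] →ₐ[ℂ] Matrix (Fin 3) (Fin 3) ℂ :=
  MonoidAlgebra.lift ℂ _ G (slMatrix.comp (SU21.subtype.comp ρ))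

theorem matrixAlgHom_of (ρ : G →* SU21) (γ : G) :
    matrixAlgHom ρ (MonoidAlgebra.of ℂ G γ) = slMatrix (ρ γ) := by
  simp [matrixAlgHom]

theorem matrixAlgHom_surjective {ρ : G →* SU21} (hρ : IsIrreducibleSU21 ρ) :
    Function.Surjective (matrixAlgHom ρ) := by
  have : Representation.IsIrreducible
    (stdRepSU21.comp ρ : Representation ℂ G (Fin 3 → ℂ)) := hρ
  intro M
  obtain ⟨a, ha⟩ := Representation.IsIrreducible.asAlgebraHom_surjective
    (stdRepSU21.comp ρ : Representation ℂ G (Fin 3 → ℂ)) (toLin' M)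
  refine ⟨a, (toLin' (R := ℂ)).injective ?_⟩
  rw [← ha]
  have : ((toLinAlgEquiv' (R := ℂ) (n := Fin 3)).toAlgHom.comp (matrixAlgHom ρ)) =
      Representation.asAlgebraHom (stdRepSU21.comp ρ : Representation ℂ G (Fin 3 → ℂ)) := by
    apply MonoidAlgebra.algHom_ext
    · intro γ
      have h := matrixAlgHom_of ρ γ
      simp only [MonoidAlgebra.of_apply] at h
      simp [h, stdRepSU21]
      rfl
    · exact Subsingleton.elim _ _
  exact congrArg (fun φ => φ a) this

/-- **Schur's lemma** for irreducible homomorphisms into `SU(2,1)`. -/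
theorem exists_eq_scalar_of_commute {ρ : G →* SU21} (hρ : IsIrreducibleSU21 ρ)
    {M : Matrix (Fin 3) (Fin 3) ℂ} (hM : ∀ γ, Commute M (slMatrix (ρ γ))) :
    ∃ c : ℂ, M = c • (1 : Matrix (Fin 3) (Fin 3) ℂ) := by
  have hall : ∀ N, Commute N M := by
    intro N
    obtain ⟨a, rfl⟩ := matrixAlgHom_surjective hρ N
    induction a using MonoidAlgebra.induction_on with
    | of γ => rw [matrixAlgHom_of]; exact (hM γ).symm
    | add a b ha hb => rw [map_add]; exact ha.add_left hb
    | smul c a ha => rw [map_smul]; exact ha.smul_left c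
  obtain ⟨c, hc⟩ := mem_range_scalar_of_commute_single fun i j _ => hall (single i j 1)
  exact ⟨c, by rw [← hc, scalar_apply, smul_one_eq_diagonal]⟩

/-- Irreducible homomorphisms into `SU(2,1)` with the same character are conjugate. -/
theorem areConjugateSU21_of_trace_eq {ρ ρ' : G →* SU21} (hρ : IsIrreducibleSU21 ρ)
    (hρ' : IsIrreducibleSU21 ρ') (h : ∀ γ, trSU21 (ρ γ) = trSU21 (ρ' γ)) :
    AreConjugateSU21 ρ ρ' := by
  have htr : ∀ a, trace (matrixAlgHom ρ a) = trace (matrixAlgHom ρ' a) := by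
    intro a
    induction a using MonoidAlgebra.induction_on with
    | of γ => rw [matrixAlgHom_of, matrixAlgHom_of]; exact h γ
    | add a b ha hb => rw [map_add, map_add, trace_add, trace_add, ha, hb]
    | smul c a ha => rw [map_smul, map_smul, trace_smul, trace_smul, ha]
  obtain ⟨g, hg, hconj⟩ := exists_conj_of_trace_eq (matrixAlgHom_surjective hρ)
    (matrixAlgHom_surjective hρ') htr
  have hdet : g.det ≠ 0 := ((isUnit_iff_isUnit_det g).1 hg).ne_zero
  -- Scaling by a cube root of `(det g)⁻¹` brings `g` into `SL₃`.
  obtain ⟨z, hz⟩ := IsAlgClosed.exists_pow_nat_eq (g.det)⁻¹ (n := 3) (by norm_num)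
  let g₀ : SpecialLinearGroup (Fin 3) ℂ :=
    ⟨z • g, by rw [det_smul, Fintype.card_fin, hz, inv_mul_cancel₀ hdet]⟩
  have hg₀ : ∀ γ, g₀.1 * slMatrix (ρ γ) = slMatrix (ρ' γ) * g₀.1 := by
    intro γ
    have := hconj (MonoidAlgebra.of ℂ G γ)
    rw [matrixAlgHom_of, matrixAlgHom_of] at this
    simp only [g₀, smul_mul_assoc, mul_smul_comm, this]
  -- The form pulled back along `g₀` is again invariant under `ρ`, so by Schur it is a multiple `c`
  -- of the original.
  set H : Matrix (Fin 3) (Fin 3) ℂ := g₀.1ᴴ * gramSU21 * g₀.1 with hH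
  have hpres : ∀ γ, (slMatrix (ρ γ))ᴴ * H * slMatrix (ρ γ) = H := by
    intro γ
    calc (slMatrix (ρ γ))ᴴ * H * slMatrix (ρ γ)
        = (g₀.1 * slMatrix (ρ γ))ᴴ * gramSU21 * (g₀.1 * slMatrix (ρ γ)) := by
          rw [conjTranspose_mul, hH]; simp only [mul_assoc]
      _ = g₀.1ᴴ * ((slMatrix (ρ' γ))ᴴ * gramSU21 * slMatrix (ρ' γ)) * g₀.1 := by
          rw [hg₀, conjTranspose_mul]; simp only [mul_assoc]
      _ = H := by rw [SU21.conjTranspose_mul_gram_mul]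
  have hcomm : ∀ γ, Commute (gramSU21 * H) (slMatrix (ρ γ)) := by
    intro γ
    have e : slMatrix (ρ γ) * (gramSU21 * (slMatrix (ρ γ))ᴴ * gramSU21) = 1 := by
      rw [← SU21.matrix_inv, SU21.matrix_mul_inv]
    have e' : slMatrix (ρ γ) * gramSU21 * (slMatrix (ρ γ))ᴴ = gramSU21 := by
      calc _ = slMatrix (ρ γ) * (gramSU21 * (slMatrix (ρ γ))ᴴ * gramSU21) * gramSU21 := by
            simp only [mul_assoc, gramSU21_mul_self, mul_one]
        _ = gramSU21 := by rw [e, one_mul]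
    calc gramSU21 * H * slMatrix (ρ γ)
        = slMatrix (ρ γ) * gramSU21 * (slMatrix (ρ γ))ᴴ * H * slMatrix (ρ γ) := by rw [e']
      _ = slMatrix (ρ γ) * gramSU21 * ((slMatrix (ρ γ))ᴴ * H * slMatrix (ρ γ)) := by
          simp only [mul_assoc]
      _ = slMatrix (ρ γ) * (gramSU21 * H) := by rw [hpres, mul_assoc]
  obtain ⟨c, hc⟩ := exists_eq_scalar_of_commute hρ hcomm
  have hHc : H = c • gramSU21 := by
    calc H = gramSU21 * (gramSU21 * H) := by rw [← mul_assoc, gramSU21_mul_self, one_mul]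
      _ = c • gramSU21 := by rw [hc, mul_smul_comm, mul_one]
  have hJ : gramSU21ᴴ = gramSU21 := by
    rw [gramSU21, diagonal_conjTranspose]
    congr 1
    ext i
    fin_cases i <;> simp
  -- `H` is Hermitian and has the determinant of `gramSU21`, so `c` is a real cube root of unity.
  have hreal : star c = c := by
    have h1 : Hᴴ = H := by
      rw [hH, conjTranspose_mul, conjTranspose_mul, conjTranspose_conjTranspose, hJ, mul_assoc]
    have := congrFun (congrFun h1 0) 0
    rw [hHc, conjTranspose_smul, hJ] at this
    simpa [gramSU21] using this
  have hcube : c ^ 3 = 1 := by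
    have h1 : H.det = gramSU21.det := by
      rw [hH, det_mul, det_mul, det_conjTranspose, g₀.2]
      simp
    have h2 : gramSU21.det = -1 := by simp [gramSU21, Fin.prod_univ_three]
    rw [hHc, det_smul, Fintype.card_fin, h2] at h1
    linear_combination -h1
  have hone : c = 1 := by
    obtain ⟨r, rfl⟩ := Complex.conj_eq_iff_real.1 hreal
    have hr : r ^ 3 = 1 := by exact_mod_cast hcube
    have : r = 1 := by nlinarith [sq_nonneg (r + 1), sq_nonneg (r - 1), sq_nonneg r]
    rw [this, Complex.ofReal_one]
  have hmem : g₀ ∈ SU21 := by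
    rw [mem_SU21_iff, ← hH, hHc, hone, one_smul]
  refine ⟨⟨g₀, hmem⟩, fun γ => ?_⟩
  rw [eq_mul_inv_iff_mul_eq]
  refine SU21.ext_matrix ?_
  simp only [Subgroup.coe_mul, map_mul]
  exact (hg₀ γ).symm

end Rep

end UnitaryGroup

/-! ### The trace coordinates determine the character -/

section Coordinates

/-- The real part of the trace of the commutator of two elements of `SU(2,1)` is determined by the
other trace coordinates, because its double is the sum of the traces of `[X, Y]` and `[Y, X]`. -/
theorem trSU21_commutator_eq {X Y X' Y' : SU21} (tX : trSU21 X = trSU21 X')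
    (tY : trSU21 Y = trSU21 Y') (tXY : trSU21 (X * Y) = trSU21 (X' * Y'))
    (txY : trSU21 (X⁻¹ * Y) = trSU21 (X'⁻¹ * Y'))
    (tc : (trSU21 (X * Y * X⁻¹ * Y⁻¹)).im = (trSU21 (X' * Y' * X'⁻¹ * Y'⁻¹)).im) :
    trSU21 (X * Y * X⁻¹ * Y⁻¹) = trSU21 (X' * Y' * X'⁻¹ * Y'⁻¹) := by
  have formula : ∀ A B : SU21,
      trSU21 (A * B * A⁻¹ * B⁻¹) + trSU21 (B * A * B⁻¹ * A⁻¹) =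
      -(trSU21 A⁻¹ * (trSU21 A + trSU21 B * trSU21 (B⁻¹ * A)
          + trSU21 (A⁻¹ * B) * trSU21 (A⁻¹ * B⁻¹)
          + (trSU21 (A * B) - trSU21 A * trSU21 B) * trSU21 B⁻¹) - trSU21 A * trSU21 A⁻¹)
      - (trSU21 A⁻¹ * (trSU21 A⁻¹ ^ 2 - 2 * trSU21 A) - trSU21 A * trSU21 A⁻¹ + 3)
      + trSU21 A⁻¹ * (trSU21 A⁻¹ ^ 2 - 2 * trSU21 A)
      + trSU21 B * (trSU21 A⁻¹ * (trSU21 A⁻¹ * trSU21 (A⁻¹ * B⁻¹) - trSU21 A * trSU21 B⁻¹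
            + trSU21 (B⁻¹ * A)) - trSU21 A * trSU21 (A⁻¹ * B⁻¹) + trSU21 B⁻¹)
      + trSU21 (A * B) * trSU21 (A⁻¹ * B⁻¹)
      + (trSU21 (A⁻¹ * B) - trSU21 B * trSU21 A⁻¹)
        * (trSU21 A⁻¹ * trSU21 (A⁻¹ * B⁻¹) - trSU21 A * trSU21 B⁻¹ + trSU21 (B⁻¹ * A)) := by
    intro A B
    have := trace_commutator_add (SU21.adjugate_matrix A)
      (by rw [SU21.adjugate_matrix, inv_inv]) (SU21.matrix_mul_inv A)
      (by simpa using SU21.matrix_mul_inv A⁻¹) (SU21.matrix_mul_inv B)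
      (by simpa using SU21.matrix_mul_inv B⁻¹)
    simpa only [trSU21, Subgroup.coe_mul, map_mul] using this
  have inv_comm : ∀ A B : SU21, trSU21 (A⁻¹ * B⁻¹) = star (trSU21 (A * B)) := by
    intro A B
    rw [← trSU21_inv, _root_.mul_inv_rev]
    simp only [trSU21, Subgroup.coe_mul, map_mul]
    exact trace_mul_comm _ _
  have inv_left : ∀ A B : SU21, trSU21 (B⁻¹ * A) = star (trSU21 (A⁻¹ * B)) := by
    intro A B
    rw [← trSU21_inv, _root_.mul_inv_rev, inv_inv]
  have commutator_inv : ∀ A B : SU21,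
      trSU21 (B * A * B⁻¹ * A⁻¹) = star (trSU21 (A * B * A⁻¹ * B⁻¹)) := by
    intro A B
    rw [← trSU21_inv]
    congr 1
    group
  have hsum : trSU21 (X * Y * X⁻¹ * Y⁻¹) + star (trSU21 (X * Y * X⁻¹ * Y⁻¹)) =
      trSU21 (X' * Y' * X'⁻¹ * Y'⁻¹) + star (trSU21 (X' * Y' * X'⁻¹ * Y'⁻¹)) := by
    rw [← commutator_inv, ← commutator_inv, formula, formula]
    simp only [inv_comm, inv_left X Y, inv_left X' Y', trSU21_inv, tX, tY, tXY, txY]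
  refine Complex.ext ?_ tc
  have := congrArg Complex.re hsum
  simp only [Complex.add_re, Complex.star_def, Complex.conj_re] at this
  linarith

variable {G : Type*} [Group G]

theorem exists_eq_smul_one_of_central {ρ : G →* SU21} (hρ : IsIrreducibleSU21 ρ) {h : G}
    (hh : ∀ γ, Commute h γ) : ∃ c : ℂ, slMatrix (ρ h) = c • (1 : Matrix (Fin 3) (Fin 3) ℂ) :=
  exists_eq_scalar_of_commute hρ fun γ =>
    (((hh γ).map ρ).map SU21.subtype).map slMatrix

/-- A scalar matrix is central, so its conjugacy class is a single point. -/
theorem SU21.eq_of_isConj_of_scalar {A B : SU21} (h : IsConj A B) {c : ℂ}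
    (hA : slMatrix A = c • (1 : Matrix (Fin 3) (Fin 3) ℂ)) : A = B := by
  obtain ⟨g, rfl⟩ := isConj_iff.1 h
  rw [eq_mul_inv_iff_mul_eq]
  refine SU21.ext_matrix ?_
  simp only [Subgroup.coe_mul, map_mul, hA, smul_mul_assoc, mul_smul_comm, one_mul, mul_one]

/-- An irreducible homomorphism into `SU(2,1)` from a group generated by `x`, `y` and a central
element `h` is determined up to conjugation by its trace coordinates. -/
theorem areConjugateSU21_iff_haveSameCoordinates {x y h : G} (hh : ∀ γ, Commute h γ)
    (hgen : Subgroup.closure {x, y, h} = ⊤) {ρ ρ' : G →* SU21} (hρ : IsIrreducibleSU21 ρ)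
    (hρ' : IsIrreducibleSU21 ρ') :
    AreConjugateSU21 ρ ρ' ↔ HaveSameCoordinates x y h ρ ρ' := by
  constructor
  · rintro ⟨g, hg⟩
    have hconj : ∀ γ, IsConj (ρ γ) (ρ' γ) := fun γ => isConj_iff.2 ⟨g, (hg γ).symm⟩
    have htr : ∀ γ, trSU21 (ρ γ) = trSU21 (ρ' γ) := fun γ => by rw [hg, trSU21_conj]
    exact ⟨⟨hconj x, hconj y, hconj h⟩, htr _, htr _, congrArg Complex.im (htr _)⟩
  rintro ⟨⟨cx, cy, ch⟩, txy, tXy, tc⟩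
  refine areConjugateSU21_of_trace_eq hρ hρ' ?_
  have tr_of_conj : ∀ {A B : SU21}, IsConj A B → trSU21 A = trSU21 B := by
    intro A B hAB
    obtain ⟨g, rfl⟩ := isConj_iff.1 hAB
    rw [trSU21_conj]
  obtain ⟨c, hc⟩ := exists_eq_smul_one_of_central hρ hh
  have hheq : ρ h = ρ' h := SU21.eq_of_isConj_of_scalar ch hc
  obtain ⟨d, hd⟩ := exists_eq_smul_one_of_central hρ (h := h⁻¹) fun γ => (hh γ).inv_left
  simp only [map_mul, map_inv] at txy tXy tc hd
  have tX := tr_of_conj cx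
  have tY := tr_of_conj cy
  have tcomm := trSU21_commutator_eq tX tY txy tXy tc
  have tcomm' := congrArg star tcomm
  rw [← trSU21_inv, ← trSU21_inv] at tcomm'
  have tXY' := congrArg star txy
  rw [← trSU21_inv, ← trSU21_inv] at tXY'
  have tXy' := congrArg star tXy
  rw [← trSU21_inv, ← trSU21_inv] at tXy'
  have tX' := congrArg star tX
  rw [← trSU21_inv, ← trSU21_inv] at tX'
  have tY' := congrArg star tY
  rw [← trSU21_inv, ← trSU21_inv] at tY'
  simp only [_root_.mul_inv_rev, inv_inv, trSU21, Subgroup.coe_mul, map_mul, ← mul_assoc]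
    at tX tY txy tXy tcomm tcomm' tXY' tXy' tX' tY'
  have inv_mul : ∀ A : SU21, slMatrix (A⁻¹ : SU21) * slMatrix A = 1 := fun A => by
    simpa using SU21.matrix_mul_inv A⁻¹
  let e (σ : G →* SU21) : Bool × Bool → Matrix (Fin 3) (Fin 3) ℂ :=
    letterMatrix (slMatrix (σ x)) (slMatrix ((σ x)⁻¹ : SU21)) (slMatrix (σ y))
      (slMatrix ((σ y)⁻¹ : SU21))
  have he : ∀ (σ : G →* SU21) l, adjugate (e σ l) = e σ (invLetter l) := by
    rintro σ ⟨_ | _, _ | _⟩ <;> simp only [e, invLetter, letterMatrix, Bool.not_true,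
      Bool.not_false, SU21.adjugate_matrix, inv_inv]
  have hwords : ∀ w : List (Bool × Bool), trace (w.map (e ρ)).prod = trace (w.map (e ρ')).prod :=
    trace_prod_eq_of_nodup (he ρ) (he ρ') <|
      trace_prod_letterMatrix_eq (SU21.matrix_mul_inv _) (inv_mul _) (SU21.matrix_mul_inv _)
        (inv_mul _) (SU21.matrix_mul_inv _) (inv_mul _) (SU21.matrix_mul_inv _) (inv_mul _)
        tX tX' tY tY' txy (by rw [trace_mul_comm, tXY', trace_mul_comm]) tXy
        (by rw [trace_mul_comm, tXy', trace_mul_comm]) tcomm tcomm'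
  -- Since `h` acts by the same scalar in both representations, one scalar and one word serve both.
  have hex : ∀ γ : G, ∃ (s : ℂ) (w : List (Bool × Bool)),
      slMatrix (ρ γ) = s • (w.map (e ρ)).prod ∧ slMatrix (ρ' γ) = s • (w.map (e ρ')).prod := by
    intro γ
    have hγ : γ ∈ Subgroup.closure {x, y, h} := hgen ▸ Subgroup.mem_top γ
    induction hγ using Subgroup.closure_induction'' with
    | one => exact ⟨1, [], by simp, by simp⟩
    | mem γ hγ =>
      rcases hγ with rfl | rfl | rfl
      · exact ⟨1, [(true, true)], by simp [e, letterMatrix], by simp [e, letterMatrix]⟩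
      · exact ⟨1, [(false, true)], by simp [e, letterMatrix], by simp [e, letterMatrix]⟩
      · exact ⟨c, [], by simp [hc], by simp [← hheq, hc]⟩
    | inv_mem γ hγ =>
      rcases hγ with rfl | rfl | rfl
      · exact ⟨1, [(true, false)], by simp [e, letterMatrix], by simp [e, letterMatrix]⟩
      · exact ⟨1, [(false, false)], by simp [e, letterMatrix], by simp [e, letterMatrix]⟩
      · refine ⟨d, [], ?_, ?_⟩
        · rw [map_inv, hd]; simp
        · rw [map_inv, ← hheq, hd]; simp
    | mul γ δ _ _ hγ hδ =>
      obtain ⟨s, w, h₁, h₁'⟩ := hγ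
      obtain ⟨t, v, h₂, h₂'⟩ := hδ
      refine ⟨s * t, w ++ v, ?_, ?_⟩
      · rw [map_mul, Subgroup.coe_mul, map_mul, h₁, h₂, List.map_append, List.prod_append,
          smul_mul_smul_comm]
      · rw [map_mul, Subgroup.coe_mul, map_mul, h₁', h₂', List.map_append, List.prod_append,
          smul_mul_smul_comm]
  intro γ
  obtain ⟨s, w, h₁, h₁'⟩ := hex γ
  rw [trSU21, trSU21, h₁, h₁', trace_smul, trace_smul, hwords]

end Coordinates

/-! ### Generators and centrality in the Brieskorn group -/

section Brieskorn

variable (p q r : ℕ) (a b c : ℤ)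

theorem brieskornElt_xyz :
    brieskornElt p q r a b c .x * brieskornElt p q r a b c .y * brieskornElt p q r a b c .z = 1 :=
  PresentedGroup.one_of_mem (rels := brieskornRels p q r a b c)
    (x := FreeGroup.of .x * FreeGroup.of .y * FreeGroup.of .z) (by simp [brieskornRels])

/-- The relation `xyz = 1` makes `z` redundant. -/
theorem closure_brieskornElt : Subgroup.closure {brieskornElt p q r a b c .x,
    brieskornElt p q r a b c .y, brieskornElt p q r a b c .h} = ⊤ := by
  set S := Subgroup.closure {brieskornElt p q r a b c .x,
    brieskornElt p q r a b c .y, brieskornElt p q r a b c .h} with hS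
  have hx : brieskornElt p q r a b c .x ∈ S := Subgroup.subset_closure (by simp)
  have hy : brieskornElt p q r a b c .y ∈ S := Subgroup.subset_closure (by simp)
  have hh : brieskornElt p q r a b c .h ∈ S := Subgroup.subset_closure (by simp)
  refine eq_top_iff.2 fun γ _ => PresentedGroup.generated_by _ S ?_ γ
  rintro (_ | _ | _ | _)
  · exact hx
  · exact hy
  · change brieskornElt p q r a b c .z ∈ S
    rw [← inv_eq_of_mul_eq_one_right (brieskornElt_xyz p q r a b c)]
    exact inv_mem (mul_mem hx hy)
  · exact hh

theorem brieskornElt_h_commute (γ : BrieskornGroup p q r a b c) :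
    Commute (brieskornElt p q r a b c .h) γ := by
  have key : ∀ u v : FreeGroup BrieskornGen, u * v * u⁻¹ * v⁻¹ ∈ brieskornRels p q r a b c →
      Commute (PresentedGroup.mk (brieskornRels p q r a b c) u) (PresentedGroup.mk _ v) := by
    intro u v huv
    have := PresentedGroup.one_of_mem huv
    rw [map_mul, map_mul, map_mul, map_inv, map_inv] at this
    exact mul_inv_eq_iff_eq_mul.1 (mul_inv_eq_one.1 this)
  have hmem : γ ∈ Subgroup.centralizer {brieskornElt p q r a b c .h} := by
    refine PresentedGroup.generated_by _ _ ?_ γ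
    intro s
    rw [Subgroup.mem_centralizer_singleton_iff]
    rcases s with _ | _ | _ | _
    · exact (key (.of .h) (.of .x) (by simp [brieskornRels])).eq.symm
    · exact (key (.of .h) (.of .y) (by simp [brieskornRels])).eq.symm
    · exact (key (.of .h) (.of .z) (by simp [brieskornRels])).eq.symm
    · rfl
  exact (Subgroup.mem_centralizer_singleton_iff.1 hmem).symm

end Brieskorn

/-- The first part is about the group given by the presentation, the second one about the
topological fundamental group of the link, for any base point and for any choice of elements
`x, y, z, h` which presents it, given as an isomorphism `e`. -/
theorem theorem3p1 (p q r : ℕ) (hp : 0 < p) (hq : 0 < q) (hr : 0 < r)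
    (hpq : Nat.Coprime p q) (hqr : Nat.Coprime q r) (hpr : Nat.Coprime p r)
    (a b c : ℤ)
    (habc : (a : ℚ) / p + (b : ℚ) / q + (c : ℚ) / r = 1 / ((p : ℚ) * q * r)) :
    (∀ ρ ρ' : BrieskornGroup p q r a b c →* SU21,
      IsIrreducibleSU21 ρ → IsIrreducibleSU21 ρ' →
        (AreConjugateSU21 ρ ρ' ↔
          HaveSameCoordinates (brieskornElt p q r a b c .x) (brieskornElt p q r a b c .y)
            (brieskornElt p q r a b c .h) ρ ρ')) ∧
    (∀ (ε : ℝ), 0 < ε → ∀ (v₀ : BrieskornSphere p q r ε)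
      (e : BrieskornGroup p q r a b c ≃* FundamentalGroup (BrieskornSphere p q r ε) v₀)
      (ρ ρ' : FundamentalGroup (BrieskornSphere p q r ε) v₀ →* SU21),
      IsIrreducibleSU21 ρ → IsIrreducibleSU21 ρ' →
        (AreConjugateSU21 ρ ρ' ↔
          HaveSameCoordinates (e (brieskornElt p q r a b c .x)) (e (brieskornElt p q r a b c .y))
            (e (brieskornElt p q r a b c .h)) ρ ρ')) := by
  refine ⟨fun ρ ρ' hρ hρ' => areConjugateSU21_iff_haveSameCoordinates
    (brieskornElt_h_commute p q r a b c) (closure_brieskornElt p q r a b c) hρ hρ', ?_⟩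
  intro ε _ v₀ e ρ ρ' hρ hρ'
  refine areConjugateSU21_iff_haveSameCoordinates (fun γ => ?_) ?_ hρ hρ'
  · simpa using (brieskornElt_h_commute p q r a b c (e.symm γ)).map e
  · have := congrArg (Subgroup.map e.toMonoidHom) (closure_brieskornElt p q r a b c)
    rw [MonoidHom.map_closure, Subgroup.map_top_of_surjective _ e.surjective] at this
    simpa [Set.image_insert_eq] using this
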